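/- Let $R$ be either a Noetherian local ring with maximal ideal $\mathfrak m$ and residue field $K=R/\mathfrak m$, or a standard graded Noetherian algebra $R=\bigoplus_{k\ge 0}R_k$ over a field $K=R_0$ with homogeneous maximal ideal $\mathfrak m=\bigoplus_{k>0}R_k$. Assume that $K$ is infinite and $\operatorname{depth}R>0$ (depth with respect to $\mathfrak m$). Let $I\subseteq R$ be an ideal, homogeneous in the graded case. An ideal $J$ of $R$ is called $\mathfrak m$-full if $(J\mathfrak m:x)=J$ for generic $x\in\mathfrak m\setminus\mathfrak m^2$, full if $(J:x)=(J:\mathfrak m)$ for generic $x\in\mathfrak m\setminus\mathfrak m^2$, and weakly $\mathfrak m$-full if $(J\mathfrak m:\mathfrak m)=J$; here a property holds for generic $x$ if there is a non-empty Zariski open subset $U$ of the $K$-vector space $\mathfrak m/\mathfrak m^2$ such that it holds for all $x\in\mathfrak m\setminus\mathfrak m^2$ whose class lies in $U$. Let $\mathfrak d_1(I),\mathfrak d_2(I),\mathfrak d_3(I)$ be the smallest $\ell\ge 0$ such that $I\mathfrak m^k$ is $\mathfrak m$-full, full, weakly $\mathfrak m$-full, respectively, for all $k\ge\ell$. Let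 $\mathcal R(\mathfrak m)=\bigoplus_{k\ge0}\mathfrak m^k$ be the Rees algebra of $\mathfrak m$, and let $$\mathfrak D_{\mathfrak m}(I)=\bigoplus_{k\ge0}\frac{(I\mathfrak m^{k+1}:\mathfrak m)}{I\mathfrak m^k}$$ be the Dao module of $I$, a graded $\mathcal R(\mathfrak m)$-module. The regularity of a finitely generated graded $\mathcal R(\mathfrak m)$-module $M$ is $\operatorname{reg}_{\mathcal R(\mathfrak m)}M=\max\{j-i : H_i(\mathbf y;M)_j\ne0\}$, where $H_i(\mathbf y;M)$ is the Koszul homology of $M$ with respect to a minimal homogeneous system of generators $\mathbf y$ of $\bigoplus_{k>0}\mathfrak m^k\subset\mathcal R(\mathfrak m)$. Then $\mathfrak d_1(I),\mathfrak d_2(I),\mathfrak d_3(I)$ exist (that is, such $\ell$ exist in all three cases), $\mathfrak D_{\mathfrak m}(I)$ is a finitely generated $\mathcal R(\mathfrak m)$-module, and $$\mathfrak d_2(I)\ \le\ \mathfrak d_1(I)=\mathfrak d_3(I)=\begin{cases}\operatorname{reg}_{\mathcal R(\mathfrak m)}\mathfrak D_{\mathfrak m}(I)+1&\text{if }\mathfrak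 D_{\mathfrak m}(I)\neq0,\\ 0&\text{otherwise,}\end{cases}$$ where, if $\mathfrak D_{\mathfrak m}(I)\ne0$, the maximum defining the regularity exists and is the same for every choice of $\mathbf y$. -/

import Mathlib

open Polynomial

universe v u

namespace DaoNumbers

/-! ### Depth, generic elements, fullness, Dao numbers -/

section Fullness

/-- The depth of `R` with respect to the ideal `m`: the supremum of the lengths of the
`R`-regular sequences contained in `m`. -/
noncomputable def depth {R : Type*} [CommRing R] (m : Ideal R) : ℕ∞ :=
  ⨆ rs : {rs : List R // (∀ r ∈ rs, r ∈ m) ∧ RingTheory.Sequence.IsRegular R rs},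
    (rs.1.length : ℕ∞)

/-- The algebra of polynomial functions `V → k`: it is generated by the linear forms. -/
def polynomialFunctions (k V : Type*) [CommRing k] [AddCommGroup V] [Module k V] :
    Subalgebra k (V → k) :=
  Algebra.adjoin k (Set.range fun φ : Module.Dual k V => (φ : V → k))

/-- Zariski open subsets of a vector space: the complements of the common zero sets of families
of polynomial functions. -/
def IsZariskiOpen (k : Type*) {V : Type*} [CommRing k] [AddCommGroup V] [Module k V]
    (U : Set V) : Prop :=
  ∃ S : Set (V → k), S ⊆ (polynomialFunctions k V : Set (V → k)) ∧ U = {v | ∃ p ∈ S, p v ≠ 0}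

variable {R : Type*} [CommRing R]

/-- The property `P` holds for a generic element `x ∈ m ∖ m²`: there is a non-empty Zariski open
subset `U` of the `R ⧸ m`-vector space `m ⧸ m²` such that `P x` holds for all `x ∈ m ∖ m²` whose
class lies in `U`. -/
def ForGeneric (m : Ideal R) (P : R → Prop) : Prop :=
  ∃ U : Set m.Cotangent, IsZariskiOpen (R ⧸ m) U ∧ U.Nonempty ∧
    ∀ x : m, (x : R) ∉ m ^ 2 → m.toCotangent x ∈ U → P x

/-- `I` is `m`-full: `(I m : x) = I` for a generic `x ∈ m ∖ m²`. -/
def IsMFull (m I : Ideal R) : Prop :=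
  ForGeneric m fun x => (I * m).colon {x} = I

/-- `I` is full: `(I : x) = (I : m)` for a generic `x ∈ m ∖ m²`. -/
def IsFull (m I : Ideal R) : Prop :=
  ForGeneric m fun x => I.colon {x} = I.colon (m : Set R)

/-- `I` is weakly `m`-full: `(I m : m) = I`. -/
def IsWeaklyMFull (m I : Ideal R) : Prop :=
  (I * m).colon (m : Set R) = I

/-- The `ℓ ≥ 0` such that `I m ^ k` is `m`-full for all `k ≥ ℓ`. -/
def daoSet₁ (m I : Ideal R) : Set ℕ := {l | ∀ k, l ≤ k → IsMFull m (I * m ^ k)}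

/-- The `ℓ ≥ 0` such that `I m ^ k` is full for all `k ≥ ℓ`. -/
def daoSet₂ (m I : Ideal R) : Set ℕ := {l | ∀ k, l ≤ k → IsFull m (I * m ^ k)}

/-- The `ℓ ≥ 0` such that `I m ^ k` is weakly `m`-full for all `k ≥ ℓ`. -/
def daoSet₃ (m I : Ideal R) : Set ℕ := {l | ∀ k, l ≤ k → IsWeaklyMFull m (I * m ^ k)}

/-- The first Dao number (the minimum of `daoSet₁ m I`, if this set is non-empty). -/
noncomputable def daoNumber₁ (m I : Ideal R) : ℕ := sInf (daoSet₁ m I)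

/-- The second Dao number (the minimum of `daoSet₂ m I`, if this set is non-empty). -/
noncomputable def daoNumber₂ (m I : Ideal R) : ℕ := sInf (daoSet₂ m I)

/-- The third Dao number (the minimum of `daoSet₃ m I`, if this set is non-empty). -/
noncomputable def daoNumber₃ (m I : Ideal R) : ℕ := sInf (daoSet₃ m I)

end Fullness

/-! ### Koszul homology and Castelnuovo–Mumford regularity -/

section Koszul

variable {A M : Type*} [CommRing A] [AddCommGroup M] [Module A M]

/-- The differential of the Koszul complex of `y = (y₁, …, yₙ)` with coefficients in `M`. The
chain `∑ c_S e_S`, where `e_S = e_{s₁} ∧ ⋯ ∧ e_{sᵢ}` for `S = {s₁ < ⋯ < sᵢ}`, is encoded as the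
family `c = (c_S)`, and `e_S` is sent to `∑ₜ (-1) ^ (t - 1) y_{sₜ} e_{S ∖ {sₜ}}`. -/
def koszulD (M : Type*) [AddCommGroup M] [Module A M] {n : ℕ} (y : Fin n → A) :
    (Finset (Fin n) → M) →ₗ[A] (Finset (Fin n) → M) where
  toFun c T := ∑ a ∈ Tᶜ, (-1 : A) ^ (T.filter (· < a)).card • y a • c (insert a T)
  map_add' c c' := by
    funext T
    simp [Finset.sum_add_distrib]
  map_smul' r c := by
    funext T
    simp only [Pi.smul_apply, RingHom.id_apply, Finset.smul_sum]
    refine Finset.sum_congr rfl fun a _ => ?_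
    rw [smul_comm r, smul_comm r]

/-- The degree `t` part of an `ℕ`-graded module, for an integer `t`. -/
def gradedPiece (ℳ : ℕ → AddSubgroup M) (t : ℤ) : AddSubgroup M :=
  if 0 ≤ t then ℳ t.toNat else ⊥

/-- The chains of homological degree `i` and internal degree `j` in the Koszul complex of `n`
elements of degree one (so that every `eₛ` has degree one). -/
def koszulChains (ℳ : ℕ → AddSubgroup M) (n i j : ℕ) : AddSubgroup (Finset (Fin n) → M) where
  carrier := {c | ∀ S : Finset (Fin n),
    (S.card = i → c S ∈ gradedPiece ℳ ((j : ℤ) - i)) ∧ (S.card ≠ i → c S = 0)}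
  zero_mem' := fun _ => ⟨fun _ => zero_mem _, fun _ => rfl⟩
  add_mem' := fun {a b} ha hb S => ⟨fun h => add_mem ((ha S).1 h) ((hb S).1 h),
    fun h => by simp [(ha S).2 h, (hb S).2 h]⟩
  neg_mem' := fun {a} ha S => ⟨fun h => neg_mem ((ha S).1 h),
    fun h => by simp [(ha S).2 h]⟩

/-- Koszul cycles of homological degree `i` and internal degree `j`. -/
def koszulCycles (ℳ : ℕ → AddSubgroup M) {n : ℕ} (y : Fin n → A) (i j : ℕ) :
    AddSubgroup (Finset (Fin n) → M) :=
  koszulChains ℳ n i j ⊓ (koszulD M y).toAddMonoidHom.ker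

/-- Koszul boundaries of homological degree `i` and internal degree `j`. -/
def koszulBoundaries (ℳ : ℕ → AddSubgroup M) {n : ℕ} (y : Fin n → A) (i j : ℕ) :
    AddSubgroup (Finset (Fin n) → M) :=
  (koszulChains ℳ n (i + 1) j).map (koszulD M y).toAddMonoidHom

/-- The degree `j` part `Hᵢ(y; M)ⱼ` of the `i`-th Koszul homology module of a sequence `y` of
elements of degree one. -/
abbrev KoszulHomology (ℳ : ℕ → AddSubgroup M) {n : ℕ} (y : Fin n → A) (i j : ℕ) : Type _ :=
  koszulCycles ℳ y i j ⧸ (koszulBoundaries ℳ y i j).addSubgroupOf (koszulCycles ℳ y i j)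

/-- `y` is a minimal homogeneous system of generators of the irrelevant ideal `Q` of the graded
ring `A`, consisting of elements of degree one. (If `A` is generated over its degree zero part by
elements of degree one, then every irredundant homogeneous system of generators of `Q` consists of
elements of degree one.) -/
structure IsMinimalGenerators (𝒜 : ℕ → AddSubgroup A) [GradedRing 𝒜] {n : ℕ} (y : Fin n → A) :
    Prop where
  mem_one : ∀ a, y a ∈ 𝒜 1
  span_eq : Ideal.span (Set.range y) = (HomogeneousIdeal.irrelevant 𝒜).toIdeal
  irredundant : ∀ a, y a ∉ Ideal.span (y '' {a}ᶜ)

/-- `reg_A M = r` for a graded module `M` over the standard graded ring `A`, that is,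
`r = max {j - i | Hᵢ(y; M)ⱼ ≠ 0}` for the minimal homogeneous systems of generators `y` of the
irrelevant ideal of `A`; the maximum exists and does not depend on `y`. -/
def HasRegularity (𝒜 : ℕ → AddSubgroup A) [GradedRing 𝒜] (ℳ : ℕ → AddSubgroup M)
    [DirectSum.Decomposition ℳ] [SetLike.GradedSMul 𝒜 ℳ] (r : ℤ) : Prop :=
  (∃ (n : ℕ) (y : Fin n → A), IsMinimalGenerators 𝒜 y) ∧
  ∀ (n : ℕ) (y : Fin n → A), IsMinimalGenerators 𝒜 y →
    IsGreatest {t : ℤ | ∃ i j : ℕ, Nontrivial (KoszulHomology ℳ y i j) ∧ t = (j : ℤ) - i} r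

end Koszul

/-! ### The grading of the Rees algebra -/

section Rees

variable {R : Type*} [CommRing R]

/-- A family of additive projections onto subgroups gives a direct sum decomposition. -/
theorem isInternal_of_projections {M : Type*} [AddCommGroup M] (ℳ : ℕ → AddSubgroup M)
    (π : ℕ → M →+ M) (hmem : ∀ k x, π k x ∈ ℳ k) (hself : ∀ k, ∀ x ∈ ℳ k, π k x = x)
    (hne : ∀ j k, j ≠ k → ∀ x ∈ ℳ j, π k x = 0)
    (hsum : ∀ x, ∃ s : Finset ℕ, ∑ k ∈ s, π k x = x) : DirectSum.IsInternal ℳ := by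
  classical
  constructor
  · rw [injective_iff_map_eq_zero]
    intro x hx
    have key : ∀ (k : ℕ) (z : DirectSum ℕ fun i => ℳ i),
        π k (DirectSum.coeAddMonoidHom ℳ z) = (z k : M) := by
      intro k z
      induction z using DirectSum.induction_on with
      | zero => simp
      | of i a =>
        rw [DirectSum.coeAddMonoidHom_of]
        by_cases h : i = k
        · subst h
          rw [hself _ _ a.2, DirectSum.of_eq_same]
        · rw [hne i k h _ a.2, DirectSum.of_eq_of_ne _ _ _ (Ne.symm h)]
          rfl
      | add x y h1 h2 =>
        rw [map_add, map_add, h1, h2, DirectSum.add_apply, AddSubgroup.coe_add]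
    ext k
    rw [← key k, hx, map_zero]
    rfl
  · intro x
    obtain ⟨s, hs⟩ := hsum x
    refine ⟨∑ k ∈ s, DirectSum.of (fun i => ℳ i) k ⟨π k x, hmem k x⟩, ?_⟩
    rw [map_sum]
    conv_rhs => rw [← hs]
    exact Finset.sum_congr rfl fun k _ => DirectSum.coeAddMonoidHom_of _ _ _

/-- The degree `k` part `m ^ k X ^ k` of the Rees algebra `⨁ m ^ k X ^ k ⊆ R[X]` of `m`. -/
def reesGrading (m : Ideal R) (k : ℕ) : AddSubgroup (reesAlgebra m) where
  carrier := {f | ∀ j, j ≠ k → (f : R[X]).coeff j = 0}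
  zero_mem' := by simp
  add_mem' := fun {a b} ha hb j hj => by simp [ha j hj, hb j hj]
  neg_mem' := fun {a} ha j hj => by simp [ha j hj]

/-- The projection of the Rees algebra onto its degree `k` part. -/
noncomputable def reesProj (m : Ideal R) (k : ℕ) : reesAlgebra m →+ reesAlgebra m where
  toFun f := ⟨monomial k ((f : R[X]).coeff k), reesAlgebra.monomial_mem.2 (f.2 k)⟩
  map_zero' := Subtype.ext (by simp)
  map_add' f g := Subtype.ext (by simp)

theorem reesGrading_isInternal (m : Ideal R) : DirectSum.IsInternal (reesGrading m) := by
  refine isInternal_of_projections _ (reesProj m) (fun k x j hj => ?_) (fun k x hx => ?_)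
    (fun j k hjk x hx => ?_) (fun x => ⟨(x : R[X]).support, ?_⟩)
  · exact coeff_monomial_of_ne _ hj
  · refine Subtype.ext (Polynomial.ext fun j => ?_)
    by_cases h : j = k
    · subst h
      exact coeff_monomial_same _ _
    · exact (coeff_monomial_of_ne _ h).trans (hx j h).symm
  · refine Subtype.ext ?_
    change monomial k ((x : R[X]).coeff k) = 0
    rw [hx k hjk.symm, monomial_zero_right]
  · refine Subtype.ext ?_
    rw [AddSubmonoidClass.coe_finsetSum]
    exact (x : R[X]).as_sum_support.symm

instance reesGradedMonoid (m : Ideal R) : SetLike.GradedMonoid (reesGrading m) where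
  one_mem := fun j hj => by simp [coeff_one, hj]
  mul_mem := fun i j f g hf hg l hl => by
    rw [Subalgebra.coe_mul, coeff_mul]
    refine Finset.sum_eq_zero fun p hp => ?_
    rw [Finset.HasAntidiagonal.mem_antidiagonal] at hp
    by_cases h : p.1 = i
    · rw [hg p.2 (by omega), mul_zero]
    · rw [hf p.1 h, zero_mul]

noncomputable instance reesGradedRing (m : Ideal R) : GradedRing (reesGrading m) where
  __ := reesGradedMonoid m
  __ := (reesGrading_isInternal m).chooseDecomposition

end Rees

/-! ### Subquotients of modules -/

section Subquotient

variable {A M : Type*} [CommRing A] [AddCommGroup M] [Module A M]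

/-- The quotient module `N / P`, for submodules `P ≤ N` of a module `M`. -/
def Subquotient (N P : Submodule A M) : Type _ := N ⧸ P.submoduleOf N

instance (N P : Submodule A M) : AddCommGroup (Subquotient N P) :=
  inferInstanceAs (AddCommGroup (N ⧸ P.submoduleOf N))

instance (N P : Submodule A M) : Module A (Subquotient N P) :=
  inferInstanceAs (Module A (N ⧸ P.submoduleOf N))

/-- The quotient map `N → N / P`. -/
def Subquotient.mk (N P : Submodule A M) : N →ₗ[A] Subquotient N P := (P.submoduleOf N).mkQ

theorem Subquotient.mk_surjective (N P : Submodule A M) :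
    Function.Surjective (Subquotient.mk N P) := (P.submoduleOf N).mkQ_surjective

theorem Subquotient.mk_eq_zero (N P : Submodule A M) (x : N) :
    Subquotient.mk N P x = 0 ↔ (x : M) ∈ P := Submodule.Quotient.mk_eq_zero _

/-- The additive endomorphism of `N / P` induced by an additive endomorphism of `N` that maps
`P` to `P`. -/
def Subquotient.map (N P : Submodule A M) (φ : N →+ N)
    (h : ∀ x : N, (x : M) ∈ P → (φ x : M) ∈ P) : Subquotient N P →+ Subquotient N P :=
  QuotientAddGroup.map (P.submoduleOf N).toAddSubgroup (P.submoduleOf N).toAddSubgroup φ h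

theorem Subquotient.map_mk (N P : Submodule A M) (φ : N →+ N)
    (h : ∀ x : N, (x : M) ∈ P → (φ x : M) ∈ P) (x : N) :
    Subquotient.map N P φ h (Subquotient.mk N P x) = Subquotient.mk N P (φ x) := rfl

end Subquotient

/-! ### The Dao module -/

section DaoModule

variable {R : Type*} [CommRing R]

/-- The `R(m)`-module `⨁ₖ (J k) X ^ k ⊆ R[X]`, for ideals `J k` with `m ^ i J k ⊆ J (i + k)`. -/
noncomputable def gradedSubmodule (m : Ideal R) (J : ℕ → Ideal R)
    (hJ : ∀ i k, m ^ i * J k ≤ J (i + k)) : Submodule (reesAlgebra m) R[X] where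
  carrier := {f | ∀ k, f.coeff k ∈ J k}
  zero_mem' := by simp
  add_mem' := fun {a b} ha hb k => by
    rw [coeff_add]
    exact add_mem (ha k) (hb k)
  smul_mem' := fun r f hf k => by
    rw [Subalgebra.smul_def, smul_eq_mul, coeff_mul]
    refine sum_mem fun p hp => ?_
    rw [Finset.HasAntidiagonal.mem_antidiagonal] at hp
    rw [← hp]
    exact hJ _ _ (Ideal.mul_mem_mul (r.2 p.1) (hf p.2))

/-- The extension `R(m, I) = ⨁ₖ (I m ^ k) X ^ k` of the ideal `I` to the Rees algebra. -/
noncomputable def extensionModule (m I : Ideal R) : Submodule (reesAlgebra m) R[X] :=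
  gradedSubmodule m (fun k => I * m ^ k) fun i k => by
    rw [mul_left_comm, pow_add]

/-- The `R(m)`-module `⨁ₖ (I m ^ (k + 1) : m) X ^ k`. -/
noncomputable def colonModule (m I : Ideal R) : Submodule (reesAlgebra m) R[X] :=
  gradedSubmodule m (fun k => (I * m ^ (k + 1)).colon (m : Set R)) fun i k => by
    rw [Ideal.mul_le]
    intro r hr s hs
    rw [Submodule.mem_colon] at hs ⊢
    intro t ht
    have h := Ideal.mul_mem_mul hr (hs t ht)
    rw [mul_left_comm, ← pow_add] at h
    simpa only [smul_eq_mul, mul_assoc, add_assoc] using h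

/-- The Dao module `D_m(I) = ⨁ₖ (I m ^ (k + 1) : m) / (I m ^ k)` over the Rees algebra of `m`. -/
abbrev DaoModule (m I : Ideal R) : Type _ :=
  Subquotient (colonModule m I) (extensionModule m I)

/-- The quotient map onto the Dao module. -/
noncomputable abbrev daoMk (m I : Ideal R) : colonModule m I →ₗ[reesAlgebra m] DaoModule m I :=
  Subquotient.mk (colonModule m I) (extensionModule m I)

/-- The degree `k` part `(I m ^ (k + 1) : m) / (I m ^ k)` of the Dao module: the classes of the
elements `a X ^ k` with `a ∈ (I m ^ (k + 1) : m)`. -/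
noncomputable def daoGrading (m I : Ideal R) (k : ℕ) : AddSubgroup (DaoModule m I) where
  carrier := {d | ∃ f : colonModule m I, (∀ j, j ≠ k → (f : R[X]).coeff j = 0) ∧
    daoMk m I f = d}
  zero_mem' := ⟨0, by simp, map_zero _⟩
  add_mem' := by
    rintro _ _ ⟨f, hf, rfl⟩ ⟨g, hg, rfl⟩
    exact ⟨f + g, fun j hj => by simp [hf j hj, hg j hj], map_add _ _ _⟩
  neg_mem' := by
    rintro _ ⟨f, hf, rfl⟩
    exact ⟨-f, fun j hj => by simp [hf j hj], (daoMk m I).toAddMonoidHom.map_neg f⟩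

/-- The projection of `⨁ₖ (I m ^ (k + 1) : m) X ^ k` onto its degree `k` part. -/
noncomputable def colonProj (m I : Ideal R) (k : ℕ) : colonModule m I →+ colonModule m I where
  toFun f := ⟨monomial k ((f : R[X]).coeff k), fun j => by
    by_cases h : j = k
    · subst h
      rw [coeff_monomial_same]
      exact f.2 j
    · rw [coeff_monomial_of_ne _ h]
      exact zero_mem _⟩
  map_zero' := Subtype.ext (by simp)
  map_add' f g := Subtype.ext (by simp)

/-- The projection of the Dao module onto its degree `k` part. -/
noncomputable def daoProj (m I : Ideal R) (k : ℕ) : DaoModule m I →+ DaoModule m I :=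
  Subquotient.map _ _ (colonProj m I k) fun f hf j => by
    change (monomial k ((f : R[X]).coeff k)).coeff j ∈ I * m ^ j
    by_cases h : j = k
    · subst h
      rw [coeff_monomial_same]
      exact hf j
    · rw [coeff_monomial_of_ne _ h]
      exact zero_mem _

theorem daoProj_mk (m I : Ideal R) (k : ℕ) (f : colonModule m I) :
    daoProj m I k (daoMk m I f) = daoMk m I (colonProj m I k f) := rfl

theorem daoGrading_isInternal (m I : Ideal R) : DirectSum.IsInternal (daoGrading m I) := by
  refine isInternal_of_projections _ (daoProj m I) (fun k x => ?_) (fun k x hx => ?_)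
    (fun j k hjk x hx => ?_) (fun x => ?_)
  · obtain ⟨f, rfl⟩ := Subquotient.mk_surjective _ _ x
    exact ⟨colonProj m I k f, fun j hj => coeff_monomial_of_ne _ hj, rfl⟩
  · obtain ⟨f, hf, rfl⟩ := hx
    rw [daoProj_mk]
    congr 1
    refine Subtype.ext (Polynomial.ext fun j => ?_)
    by_cases h : j = k
    · subst h
      exact coeff_monomial_same _ _
    · exact (coeff_monomial_of_ne _ h).trans (hf j h).symm
  · obtain ⟨f, hf, rfl⟩ := hx
    rw [daoProj_mk, ← map_zero (daoMk m I)]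
    congr 1
    refine Subtype.ext ?_
    change monomial k ((f : R[X]).coeff k) = 0
    rw [hf k hjk.symm, monomial_zero_right]
  · obtain ⟨f, rfl⟩ := Subquotient.mk_surjective _ _ x
    refine ⟨(f : R[X]).support, ?_⟩
    simp only [daoProj_mk]
    rw [← map_sum (daoMk m I)]
    congr 1
    refine Subtype.ext ?_
    rw [AddSubmonoidClass.coe_finsetSum]
    exact (f : R[X]).as_sum_support.symm

noncomputable instance daoDecomposition (m I : Ideal R) :
    DirectSum.Decomposition (daoGrading m I) :=
  (daoGrading_isInternal m I).chooseDecomposition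

instance daoGradedSMul (m I : Ideal R) :
    SetLike.GradedSMul (reesGrading m) (daoGrading m I) where
  smul_mem := by
    rintro i j r _ hr ⟨f, hf, rfl⟩
    refine ⟨r • f, fun l hl => ?_, map_smul _ _ _⟩
    rw [Submodule.coe_smul, Subalgebra.smul_def, smul_eq_mul, coeff_mul]
    refine Finset.sum_eq_zero fun p hp => ?_
    rw [Finset.HasAntidiagonal.mem_antidiagonal] at hp
    by_cases h : p.1 = i
    · rw [hf p.2 (by rw [vadd_eq_add] at hl; omega), mul_zero]
    · rw [hr p.1 h, zero_mul]

end DaoModule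

/-! ### Local rings and standard graded algebras -/

section Setting

/-- `R` is a standard graded `K`-algebra with respect to the grading `𝒜`: its degree zero part is
`K`, and it is generated as a `K`-algebra by finitely many elements of degree one. -/
structure IsStandardGraded {K R : Type*} [Field K] [CommRing R] [Algebra K R]
    (𝒜 : ℕ → Submodule K R) [GradedAlgebra 𝒜] : Prop where
  algebraMap_injective : Function.Injective (algebraMap K R)
  zero_eq : 𝒜 0 = 1
  finite_one : Module.Finite K (𝒜 1)
  adjoin_one : Algebra.adjoin K (𝒜 1 : Set R) = ⊤

/-- `R` is a local ring with maximal ideal `m`. -/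
def IsLocalSetting {R : Type*} [CommRing R] (m : Ideal R) : Prop :=
  ∃ _ : IsLocalRing R, m = IsLocalRing.maximalIdeal R

/-- `R` carries the structure of a standard graded algebra over a field such that `m` is the
homogeneous maximal ideal (generated by the elements of positive degree) and `I` is homogeneous. -/
def IsGradedSetting {R : Type u} [CommRing R] (m I : Ideal R) : Prop :=
  ∃ (K : Type v) (_ : Field K) (_ : Algebra K R) (𝒜 : ℕ → Submodule K R) (_ : GradedAlgebra 𝒜),
    IsStandardGraded 𝒜 ∧ m = (HomogeneousIdeal.irrelevant 𝒜).toIdeal ∧ I.IsHomogeneous 𝒜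

end Setting

end DaoNumbers

open DaoNumbers

/-! A generic `x` in `m` is superficial for `I`: for all large `k`, `(I m ^ (k + 1) : x) = I m ^ k`.
Only finitely many proper subspaces of `m ⧸ m²` must be avoided. They come from the primary
components of extension ideals in the Rees algebra (`exists_finset_superficial`), and positive depth
together with Artin–Rees removes the restriction to elements of `m ^ k` (`exists_colon_eq`). Over an
infinite field the complement of these subspaces contains a non-empty Zariski open set, the same for
all `k`.

The bound on `k` depends on `x`, but descending induction pushes the equality down through every
range of exponents in which the `I m ^ k` are weakly `m`-full (`colon_eq_of_isWeaklyMFull`). So,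
from some exponent on, weak `m`-fullness implies `m`-fullness. Conversely, each `m`-full ideal is
full and weakly `m`-full. This gives existence, `d₂ ≤ d₁` and `d₁ = d₃`.

The Dao module is killed by the irrelevant ideal, since `m (I m ^ (k + 1) : m) ⊆ I m ^ (k + 1)`. Its
Koszul differentials vanish, so its regularity is its top degree (`hasRegularity_of_smul_eq_zero`).
Its degree `k` part is zero exactly when `I m ^ k` is weakly `m`-full (`daoGrading_eq_bot_iff`), so
the top degree is `d₃ - 1`.

The local and the graded case share one argument: the only input is that the ideals involved are
saturated with respect to the complement of `m`. -/

namespace DaoNumbers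

/-! ### Superficial elements from primary decomposition in the Rees algebra -/

section Superficial

variable {R : Type*} [CommRing R]

/-- The `R`-linear map `m → R(m)`, `a ↦ a X`. -/
noncomputable def reesDegreeOne (m : Ideal R) : m →ₗ[R] reesAlgebra m where
  toFun a := ⟨monomial 1 (a : R), reesAlgebra.monomial_mem.2 (by simp)⟩
  map_add' a b := Subtype.ext (by simp)
  map_smul' r a := Subtype.ext (by simp [smul_monomial])

/-- The ideal of the Rees algebra of `m` generated by the elements `a X` with `a ∈ m`. -/
noncomputable def reesIrrelevant (m : Ideal R) : Ideal (reesAlgebra m) :=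
  Ideal.span (Set.range (reesDegreeOne m))

theorem monomial_mem_reesIrrelevant_pow (m : Ideal R) (p : ℕ) {b : R} (hb : b ∈ m ^ p) :
    (⟨monomial p b, reesAlgebra.monomial_mem.2 hb⟩ : reesAlgebra m) ∈ reesIrrelevant m ^ p := by
  induction p generalizing b with
  | zero => simp
  | succ p ih =>
    -- The membership in the Rees algebra stays quantified, so that the induction on `c` can supply
    -- it for each summand.
    have key : ∀ c ∈ m * m ^ p, ∀ hc : monomial (p + 1) c ∈ reesAlgebra m,
        (⟨monomial (p + 1) c, hc⟩ : reesAlgebra m) ∈ reesIrrelevant m ^ (p + 1) := by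
      intro c hc
      induction hc using Submodule.mul_induction_on' with
      | mem_mul_mem a ha c hc =>
        intro _
        have ha' : reesDegreeOne m ⟨a, ha⟩ ∈ reesIrrelevant m := Ideal.subset_span ⟨_, rfl⟩
        have := Ideal.mul_mem_mul ha' (ih hc)
        rw [← pow_succ'] at this
        convert this using 1
        refine Subtype.ext ?_
        change monomial (p + 1) (a * c) = monomial 1 a * monomial p c
        rw [monomial_mul_monomial, add_comm]
      | add c hc d hd h1 h2 =>
        intro _
        rw [← pow_succ'] at hc hd
        convert add_mem (h1 (reesAlgebra.monomial_mem.2 hc)) (h2 (reesAlgebra.monomial_mem.2 hd))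
        exact map_add _ _ _
    exact key b (by rwa [← pow_succ']) _

/-- The ideal `⨁ₖ (J m ^ k ∩ m ^ k) X ^ k` of the Rees algebra of `m`. -/
noncomputable def extensionIdeal (m J : Ideal R) : Ideal (reesAlgebra m) :=
  (extensionModule m J).comap (Algebra.linearMap (reesAlgebra m) R[X])

theorem mem_extensionIdeal {m J : Ideal R} {f : reesAlgebra m} :
    f ∈ extensionIdeal m J ↔ ∀ k, (f : R[X]).coeff k ∈ J * m ^ k := Iff.rfl

theorem reesDegreeOne_mul_mem_extensionIdeal {m J : Ideal R} {x : m} {g : reesAlgebra m} :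
    reesDegreeOne m x * g ∈ extensionIdeal m J ↔
      ∀ k, (x : R) * (g : R[X]).coeff k ∈ J * m ^ (k + 1) := by
  rw [mem_extensionIdeal]
  change (∀ k, (monomial 1 (x : R) * (g : R[X])).coeff k ∈ J * m ^ k) ↔ _
  refine ⟨fun h k => ?_, fun h k => ?_⟩
  · simpa only [coeff_monomial_mul] using h (k + 1)
  · cases k with
    | zero => simp
    | succ k => simpa only [coeff_monomial_mul] using h k

/-- Elements outside `m` are nonzerodivisors modulo `J`. -/
def IsSaturatedAt (m J : Ideal R) : Prop := ∀ s f : R, s ∉ m → s * f ∈ J → f ∈ J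

/-- The `R ⧸ m`-subspace of `m ⧸ m²` spanned by a submodule of `m`. -/
def cotangentMap (m : Ideal R) (N : Submodule R m) : Submodule (R ⧸ m) m.Cotangent where
  carrier := N.map m.toCotangent
  zero_mem' := zero_mem _
  add_mem' := fun ha hb => add_mem ha hb
  smul_mem' := fun c v hv => by
    obtain ⟨c, rfl⟩ := Ideal.Quotient.mk_surjective c
    exact Submodule.smul_mem (N.map m.toCotangent) c hv

/-- Nakayama's lemma for `m ⧸ N` without localizing: the hypothesis says `m = N + m²`, so some `s ≡
1` modulo `m` kills `m ⧸ N`. -/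
theorem exists_smul_mem_of_cotangentMap_eq_top {m : Ideal R} (hm : m.FG) (hm1 : m ≠ ⊤)
    {N : Submodule R m} (h : cotangentMap m N = ⊤) : ∃ s, s ∉ m ∧ ∀ a : m, s • a ∈ N := by
  have : Module.Finite R m := Module.Finite.iff_fg.2 hm
  have hle : (⊤ : Submodule R (m ⧸ N)) ≤ m • ⊤ := by
    rintro y -
    obtain ⟨a, rfl⟩ := N.mkQ_surjective y
    have ha : m.toCotangent a ∈ cotangentMap m N := h ▸ Submodule.mem_top
    obtain ⟨b, hb, hab⟩ := ha
    have h2 : a - b ∈ (m • ⊤ : Submodule R m) := by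
      rw [← Submodule.Quotient.mk_eq_zero, Submodule.Quotient.mk_sub, sub_eq_zero]
      exact hab.symm
    have h3 : N.mkQ (a - b) ∈ (m • ⊤ : Submodule R m).map N.mkQ := ⟨_, h2, rfl⟩
    rw [Submodule.map_smul'', Submodule.map_top, Submodule.range_mkQ, map_sub] at h3
    rwa [show N.mkQ b = 0 from (Submodule.Quotient.mk_eq_zero N).2 hb, sub_zero] at h3
  obtain ⟨r, hr, hr'⟩ := Submodule.exists_sub_one_mem_and_smul_eq_zero_of_fg_of_le_smul m
    (⊤ : Submodule R (m ⧸ N)) Module.Finite.fg_top hle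
  refine ⟨r, fun hrm => hm1 ((Ideal.eq_top_iff_one m).2 ?_), fun a => ?_⟩
  · simpa using sub_mem hrm hr
  · rw [← Submodule.Quotient.mk_eq_zero]
    exact hr' (N.mkQ a) Submodule.mem_top

/-- If `a X` lies outside the radical of `Q`, it is a nonzerodivisor modulo `Q`, so the classes to
avoid are those of the `a` with `a X` in the radical. By Nakayama they form a proper subspace,
unless the radical contains the irrelevant ideal or some `s ∉ m`. The factors `c` and `s` in the
conclusion absorb these two cases. -/
theorem exists_subspace_of_isPrimary [IsNoetherianRing R] {m : Ideal R} (hm : m.IsPrime)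
    [Nontrivial m.Cotangent] {Q : Ideal (reesAlgebra m)} (hQ : Q.IsPrimary) :
    ∃ W : Submodule (R ⧸ m) m.Cotangent, W ≠ ⊤ ∧ ∀ x : m, m.toCotangent x ∉ W →
      ∃ s, s ∉ m ∧ ∃ n, ∀ c ∈ reesIrrelevant m ^ n, ∀ g, reesDegreeOne m x * g ∈ Q →
        algebraMap R (reesAlgebra m) s * (c * g) ∈ Q := by
  have hQ' : ∀ {a b}, a * b ∈ Q → a ∈ Q ∨ b ∈ Q.radical := (Ideal.isPrimary_iff.1 hQ).2
  by_cases h1 : reesIrrelevant m ≤ Q.radical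
  · obtain ⟨n, hn⟩ := Ideal.exists_pow_le_of_le_radical_of_fg h1 (IsNoetherian.noetherian _)
    -- No condition on `x` is needed here; `⊥` is just some proper subspace, as `m ⧸ m²` is nonzero.
    exact ⟨⊥, bot_ne_top, fun x _ => ⟨1, (Ideal.ne_top_iff_one m).1 hm.ne_top, n, fun c hc g _ =>
      Ideal.mul_mem_left _ _ (Ideal.mul_mem_right _ _ (hn hc))⟩⟩
  by_cases h2 : ∃ s, s ∉ m ∧ algebraMap R (reesAlgebra m) s ∈ Q.radical
  · obtain ⟨s, hs, n, hn⟩ := h2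
    refine ⟨⊥, bot_ne_top, fun x _ => ⟨s ^ n, fun h => hs (hm.mem_of_pow_mem n h), 0, fun c hc g _ => ?_⟩⟩
    rw [map_pow]
    exact Ideal.mul_mem_right _ _ hn
  push Not at h2
  refine ⟨cotangentMap m ((Q.radical.restrictScalars R).comap (reesDegreeOne m)), fun htop => ?_,
    fun x hx => ⟨1, (Ideal.ne_top_iff_one m).1 hm.ne_top, 0, fun c _ g hg => ?_⟩⟩
  · obtain ⟨s, hs, hs'⟩ := exists_smul_mem_of_cotangentMap_eq_top (IsNoetherian.noetherian m)
      hm.ne_top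
      htop
    refine h1 (Ideal.span_le.2 ?_)
    rintro _ ⟨a, rfl⟩
    have h := hs' a
    rw [Submodule.mem_comap, map_smul, Algebra.smul_def] at h
    exact ((Ideal.isPrime_radical hQ).mem_or_mem h).resolve_left (h2 s hs)
  · rw [mul_comm] at hg
    have h := (hQ' hg).resolve_right fun h => hx ⟨x, h, rfl⟩
    exact Ideal.mul_mem_left _ _ (Ideal.mul_mem_left _ _ h)

theorem exists_finset_subspaces [IsNoetherianRing R] {m : Ideal R} (hm : m.IsPrime)
    [Nontrivial m.Cotangent] (E : Ideal (reesAlgebra m)) :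
    ∃ T : Finset (Submodule (R ⧸ m) m.Cotangent), ⊤ ∉ T ∧ ∀ x : m,
      (∀ W ∈ T, m.toCotangent x ∉ W) →
      ∃ s, s ∉ m ∧ ∃ n, ∀ c ∈ reesIrrelevant m ^ n, ∀ g, reesDegreeOne m x * g ∈ E →
        algebraMap R (reesAlgebra m) s * (c * g) ∈ E := by
  classical
  obtain ⟨S, rfl, hS⟩ := Submodule.isLasker (reesAlgebra m) (reesAlgebra m) E
  refine Finset.inf_induction (p := fun E : Ideal (reesAlgebra m) =>
    ∃ T : Finset (Submodule (R ⧸ m) m.Cotangent), ⊤ ∉ T ∧ ∀ x : m,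
      (∀ W ∈ T, m.toCotangent x ∉ W) →
      ∃ s, s ∉ m ∧ ∃ n, ∀ c ∈ reesIrrelevant m ^ n, ∀ g, reesDegreeOne m x * g ∈ E →
        algebraMap R (reesAlgebra m) s * (c * g) ∈ E) ?_ ?_ fun Q hQ => ?_
  · exact ⟨∅, by simp, fun x _ => ⟨1, (Ideal.ne_top_iff_one m).1 hm.ne_top, 0, by simp⟩⟩
  · rintro E₁ ⟨T₁, h₁, H₁⟩ E₂ ⟨T₂, h₂, H₂⟩
    refine ⟨T₁ ∪ T₂, by simp [h₁, h₂], fun x hx => ?_⟩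
    obtain ⟨s, hs, n, H₁⟩ := H₁ x fun W hW => hx W (Finset.mem_union_left _ hW)
    obtain ⟨t, ht, p, H₂⟩ := H₂ x fun W hW => hx W (Finset.mem_union_right _ hW)
    refine ⟨s * t, fun h => (hm.mem_or_mem h).elim hs ht, n + p, fun c hc g hg => ⟨?_, ?_⟩⟩
    · rw [map_mul, mul_comm (algebraMap R _ s), mul_assoc]
      exact Ideal.mul_mem_left _ _ (H₁ c (Ideal.pow_le_pow_right (by omega) hc) g hg.1)
    · rw [map_mul, mul_assoc]
      exact Ideal.mul_mem_left _ _ (H₂ c (Ideal.pow_le_pow_right (by omega) hc) g hg.2)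
  · obtain ⟨W, hW, H⟩ := exists_subspace_of_isPrimary hm (hS hQ)
    exact ⟨{W}, by simpa using hW.symm, fun x hx => H x (hx W (by simp))⟩

/-- The ideal `N = (E : x X)`, with `E` the extension of `J`, is generated in degrees at most `d`.
In degree `k ≥ d + n` each generator component is multiplied by an element of degree at least `n`,
hence of the `n`-th power of the irrelevant ideal, which carries `N` into `E` up to a factor `s ∉
m`. Saturation cancels `s`. -/
theorem exists_finset_superficial [IsNoetherianRing R] {m : Ideal R} (hm : m.IsPrime)
    [Nontrivial m.Cotangent] {J : Ideal R} (hJ : ∀ k, IsSaturatedAt m (J * m ^ k)) :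
    ∃ T : Finset (Submodule (R ⧸ m) m.Cotangent), ⊤ ∉ T ∧ ∀ x : m,
      (∀ W ∈ T, m.toCotangent x ∉ W) →
      ∃ k₀, ∀ k, k₀ ≤ k → ∀ f ∈ m ^ k, (x : R) * f ∈ J * m ^ (k + 1) → f ∈ J * m ^ k := by
  classical
  obtain ⟨T, hT, H⟩ := exists_finset_subspaces hm (extensionIdeal m J)
  refine ⟨T, hT, fun x hx => ?_⟩
  obtain ⟨s, hs, n, H⟩ := H x hx
  let N : Ideal (reesAlgebra m) :=
    Submodule.comap (LinearMap.mulLeft (reesAlgebra m) (reesDegreeOne m x)) (extensionIdeal m J)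
  obtain ⟨G, hG⟩ : N.FG := IsNoetherian.noetherian N
  have hN : ∀ g, g ∈ N ↔ ∀ k, (x : R) * (g : R[X]).coeff k ∈ J * m ^ (k + 1) := fun g =>
    reesDegreeOne_mul_mem_extensionIdeal
  have hmono : ∀ {k f}, f ∈ m ^ k → (x : R) * f ∈ J * m ^ (k + 1) →
      ∃ h, (⟨monomial k f, h⟩ : reesAlgebra m) ∈ N := by
    intro k f hf hxf
    refine ⟨reesAlgebra.monomial_mem.2 hf, (hN _).2 fun j => ?_⟩
    rcases eq_or_ne j k with rfl | h
    · simpa using hxf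
    · simp [coeff_monomial_of_ne _ h]
  let d := G.sup fun g => (g : R[X]).natDegree
  refine ⟨d + n, fun k hk f hf hxf => ?_⟩
  obtain ⟨_, hfN⟩ := hmono hf hxf
  rw [← hG] at hfN
  obtain ⟨a, -, ha⟩ := Submodule.mem_span_finset.1 hfN
  have hf' := congrArg (fun q : reesAlgebra m => (q : R[X]).coeff k) ha
  simp only [coeff_monomial_same] at hf'
  rw [← hf', AddSubmonoidClass.coe_finsetSum, finsetSum_coeff]
  refine sum_mem fun g hg => ?_
  rw [smul_eq_mul, Subalgebra.coe_mul, coeff_mul]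
  refine sum_mem fun ⟨p, q⟩ hpq => ?_
  rw [Finset.HasAntidiagonal.mem_antidiagonal] at hpq
  dsimp only at hpq ⊢
  by_cases hq : d < q
  · have : (g : R[X]).coeff q = 0 := coeff_eq_zero_of_natDegree_lt
      ((Finset.le_sup (f := fun g : reesAlgebra m => (g : R[X]).natDegree) hg).trans_lt hq)
    simp [this]
  have hgN : g ∈ N := hG ▸ Submodule.subset_span hg
  -- The generators need not be homogeneous, but `N` contains their components.
  obtain ⟨_, hgq⟩ := hmono (g.2 q) ((hN g).1 hgN q)
  have h := H _ (Ideal.pow_le_pow_right (by omega)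
    (monomial_mem_reesIrrelevant_pow m p ((a g).2 p))) _ hgq
  have h' : (algebraMap R R[X] s * (monomial p (((a g : reesAlgebra m) : R[X]).coeff p) *
      monomial q ((g : R[X]).coeff q))).coeff k ∈ J * m ^ k := mem_extensionIdeal.1 h k
  rw [monomial_mul_monomial, hpq, ← C_eq_algebraMap, coeff_C_mul, coeff_monomial_same] at h'
  exact hJ k s _ hs h'

end Superficial

/-! ### Zariski open sets and generic elements -/

section Generic

variable {R : Type*} [CommRing R]

theorem exists_isZariskiOpen_avoiding {k V : Type*} [Field k] [Infinite k] [AddCommGroup V]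
    [Module k V] (T : Finset (Submodule k V)) (hT : ⊤ ∉ T) :
    ∃ U : Set V, IsZariskiOpen k U ∧ U.Nonempty ∧ ∀ v ∈ U, ∀ W ∈ T, v ∉ W := by
  classical
  have h : ∀ W : Submodule k V, ∃ φ : Module.Dual k V, W ∈ T → φ ≠ 0 ∧ W ≤ LinearMap.ker φ := by
    intro W
    by_cases hW : W ∈ T
    · obtain ⟨φ, h⟩ := Submodule.exists_le_ker_of_lt_top W
        (lt_top_iff_ne_top.2 fun h => hT (h ▸ hW))
      exact ⟨φ, fun _ => h⟩
    · exact ⟨0, fun h => absurd h hW⟩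
  choose φ hφ using h
  refine ⟨{v | ∃ p ∈ ({∏ W ∈ T, (φ W : V → k)} : Set (V → k)), p v ≠ 0}, ⟨_, ?_, rfl⟩, ?_, ?_⟩
  · rw [Set.singleton_subset_iff]
    exact Subalgebra.prod_mem _ fun W _ => Algebra.subset_adjoin ⟨φ W, rfl⟩
  -- A vector space over an infinite field is not a finite union of proper subspaces. The kernels
  -- replace the `W` because the open set is where the product of the forms `φ W` is nonzero.
  · have hs : (⊤ : Submodule k V) ∉ T.image fun W => LinearMap.ker (φ W) := by
      simp only [Finset.mem_image, not_exists, not_and]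
      exact fun W hW h => (hφ W hW).1 (LinearMap.ker_eq_top.1 h)
    have := Subspace.biUnion_ne_univ_of_top_notMem hs
    obtain ⟨v, hv⟩ := (Set.ne_univ_iff_exists_notMem _).1 this
    refine ⟨v, _, rfl, ?_⟩
    rw [Finset.prod_apply, Finset.prod_ne_zero_iff]
    intro W hW h0
    exact hv (Set.mem_biUnion (Finset.mem_image_of_mem _ hW) (LinearMap.mem_ker.2 h0))
  · rintro v ⟨_, rfl, hv⟩ W hW hvW
    rw [Finset.prod_apply, Finset.prod_ne_zero_iff] at hv
    exact hv W hW ((hφ W hW).2 hvW)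

theorem exists_polynomial_eval_smul {k V : Type*} [CommRing k] [AddCommGroup V] [Module k V]
    {p : V → k} (hp : p ∈ polynomialFunctions k V) (v : V) :
    ∃ q : k[X], ∀ t : k, p (t • v) = q.eval t := by
  induction hp using Algebra.adjoin_induction with
  | mem p hp =>
    obtain ⟨φ, rfl⟩ := hp
    exact ⟨C (φ v) * X, fun t => by
      change φ (t • v) = _
      rw [map_smul, eval_mul, eval_C, eval_X, smul_eq_mul, mul_comm]⟩
  | algebraMap r => exact ⟨C r, fun t => eval_C.symm⟩
  | add p q _ _ hp hq =>
    obtain ⟨a, ha⟩ := hp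
    obtain ⟨b, hb⟩ := hq
    exact ⟨a + b, fun t => by simp [ha, hb]⟩
  | mul p q _ _ hp hq =>
    obtain ⟨a, ha⟩ := hp
    obtain ⟨b, hb⟩ := hq
    exact ⟨a * b, fun t => by simp [ha, hb]⟩

/-- Needed because genericity only speaks of `x ∉ m²`, that is, of nonzero classes. If `0` lies in
`U`, restrict a polynomial nonvanishing at `0` to a line and find a parameter `t ≠ 0` at which it is
nonzero; multiplying by `X` enforces `t ≠ 0`. -/
theorem IsZariskiOpen.exists_ne_zero {k V : Type*} [Field k] [Infinite k] [AddCommGroup V]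
    [Module k V] [Nontrivial V] {U : Set V} (hU : IsZariskiOpen k U) (hne : U.Nonempty) :
    ∃ v ∈ U, v ≠ 0 := by
  obtain ⟨w, hw⟩ := hne
  by_cases hw0 : w = 0
  · subst hw0
    obtain ⟨S, hS, rfl⟩ := hU
    obtain ⟨p, hp, hp0⟩ := hw
    obtain ⟨v, hv⟩ := exists_ne (0 : V)
    obtain ⟨q, hq⟩ := exists_polynomial_eval_smul (hS hp) v
    have hq0 : q * X ≠ 0 := by
      refine mul_ne_zero ?_ X_ne_zero
      rintro rfl
      exact hp0 (by simpa using hq 0)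
    obtain ⟨t, ht⟩ : ∃ t, (q * X).eval t ≠ 0 := by
      by_contra! h
      exact hq0 (Polynomial.funext fun t => (h t).trans eval_zero.symm)
    rw [eval_mul, eval_X] at ht
    exact ⟨t • v, ⟨p, hp, by rw [hq]; exact left_ne_zero_of_mul ht⟩,
      smul_ne_zero (right_ne_zero_of_mul ht) hv⟩
  · exact ⟨w, hw, hw0⟩

theorem ForGeneric.mono {m : Ideal R} {P Q : R → Prop} (h : ForGeneric m P)
    (hPQ : ∀ x ∈ m, P x → Q x) : ForGeneric m Q := by
  obtain ⟨U, hU, hne, hP⟩ := h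
  exact ⟨U, hU, hne, fun x hx hxU => hPQ x x.2 (hP x hx hxU)⟩

theorem ForGeneric.exists {m : Ideal R} [m.IsMaximal] [Infinite (R ⧸ m)] [Nontrivial m.Cotangent]
    {P : R → Prop} (h : ForGeneric m P) : ∃ x ∈ m, P x := by
  let _ := Ideal.Quotient.field m
  obtain ⟨U, hU, hne, hP⟩ := h
  obtain ⟨v, hv, hv0⟩ := IsZariskiOpen.exists_ne_zero hU hne
  obtain ⟨x, rfl⟩ := m.toCotangent_surjective v
  exact ⟨x, x.2, hP x (fun h => hv0 ((m.toCotangent_eq_zero x).2 h)) hv⟩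

end Generic

/-! ### Colon ideals by generic elements and comparison of the fullness conditions -/

section Superficial

variable {R : Type*} [CommRing R]

theorem exists_mem_isSMulRegular_of_depth_pos {m : Ideal R} (h : 0 < depth m) :
    ∃ a ∈ m, IsSMulRegular R a := by
  obtain ⟨⟨rs, hrs, hreg⟩, h0⟩ := lt_iSup_iff.1 h
  cases rs with
  | nil => simp at h0
  | cons a rs =>
    exact ⟨a, hrs a (by simp),
      ((RingTheory.Sequence.isWeaklyRegular_cons_iff R a rs).1 hreg.toIsWeaklyRegular).1⟩

/-- If `m = m²`, then `m` is generated by an idempotent `e`. Then `a = a e`, and cancelling `a`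
gives `e = 1`. -/
theorem nontrivial_cotangent [IsNoetherianRing R] {m : Ideal R} (hm : m ≠ ⊤) {a : R}
    (ha : a ∈ m) (hreg : IsSMulRegular R a) : Nontrivial m.Cotangent := by
  by_contra h
  rw [not_nontrivial_iff_subsingleton, Ideal.cotangent_subsingleton_iff,
    Ideal.isIdempotentElem_iff_of_fg m (IsNoetherian.noetherian m)] at h
  obtain ⟨e, he, hspan⟩ := h
  rw [hspan, Ideal.submodule_span_eq, Ideal.mem_span_singleton] at ha
  obtain ⟨c, rfl⟩ := ha
  refine hm ((Ideal.eq_top_iff_one m).2 ?_)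
  have h1 : (1 : R) = e := hreg (by
    change e * c * 1 = e * c * e
    rw [mul_one, mul_right_comm, he.eq])
  rw [h1, hspan]
  exact Ideal.subset_span rfl

theorem le_colon_singleton {m J : Ideal R} {x : R} (hx : x ∈ m) : J ≤ (J * m).colon {x} :=
  fun _ hf => Submodule.mem_colon_singleton.2 (Ideal.mul_mem_mul hf hx)

/-- Artin–Rees for the ideal `(x)`, followed by cancelling `x`. -/
theorem exists_pow_mem_of_mul_mem_pow [IsNoetherianRing R] (m : Ideal R) {x : R}
    (hx : ∀ f, x * f = 0 → f = 0) :
    ∃ c, ∀ n, ∀ f, x * f ∈ m ^ (n + c) → f ∈ m ^ n := by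
  obtain ⟨c, hc⟩ := Ideal.exists_pow_inf_eq_pow_smul m (Ideal.span {x})
  refine ⟨c, fun n f hf => ?_⟩
  have h : x * f ∈ m ^ (n + c) • (⊤ : Ideal R) ⊓ Ideal.span {x} :=
    ⟨by simpa using hf, Ideal.mul_mem_right _ _ (Ideal.mem_span_singleton_self x)⟩
  rw [hc (n + c) (by omega), Nat.add_sub_cancel] at h
  have h' : x * f ∈ Ideal.span {x} * m ^ n := by
    rw [mul_comm]
    exact Submodule.smul_mono le_rfl inf_le_right h
  obtain ⟨g, hg, hgf⟩ := Ideal.mem_span_singleton_mul.1 h'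
  have : f = g := sub_eq_zero.1 (hx _ (by rw [mul_sub, hgf, sub_self]))
  exact this ▸ hg

/-- The hypotheses are superficiality for `⊥`, `m` and `I`. The first makes `x` a nonzerodivisor,
because powers of `a` move any element into `m ^ k₁`. Then if `x f ∈ I m ^ (k + 1)`, Artin–Rees puts
`f` into `m ^ k₂`, the second raises this step by step to `m ^ k`, and the third applies. -/
theorem exists_colon_eq [IsNoetherianRing R] {m I : Ideal R} {a x : R} (ha : a ∈ m)
    (hreg : IsSMulRegular R a) (hx : x ∈ m) {k₁ k₂ k₃ : ℕ}
    (h₁ : ∀ f ∈ m ^ k₁, x * f = 0 → f = 0)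
    (h₂ : ∀ k, k₂ ≤ k → ∀ f ∈ m ^ k, x * f ∈ m ^ (k + 2) → f ∈ m ^ (k + 1))
    (h₃ : ∀ k, k₃ ≤ k → ∀ f ∈ m ^ k, x * f ∈ I * m ^ (k + 1) → f ∈ I * m ^ k) :
    ∃ k₀, ∀ k, k₀ ≤ k → (I * m ^ k * m).colon {x} = I * m ^ k := by
  have hx0 : ∀ f, x * f = 0 → f = 0 := by
    intro f hf
    have h := h₁ (a ^ k₁ * f) (Ideal.mul_mem_right _ _ (Ideal.pow_mem_pow ha _))
      (by rw [mul_left_comm, hf, mul_zero])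
    refine hreg.pow k₁ ?_
    simpa only [smul_eq_mul, mul_zero] using h
  obtain ⟨c, hc⟩ := exists_pow_mem_of_mul_mem_pow m hx0
  refine ⟨k₂ + c + k₃, fun k hk => le_antisymm (fun f hf => ?_) (le_colon_singleton hx)⟩
  have hf' : x * f ∈ I * m ^ (k + 1) := by
    have h := Submodule.mem_colon_singleton.1 hf
    rwa [smul_eq_mul, mul_comm f, mul_assoc, ← pow_succ] at h
  have hxf : x * f ∈ m ^ (k + 1) := Ideal.mul_le_right hf'
  have hle : m ^ (k + 1) ≤ m ^ (k₂ + c) := Ideal.pow_le_pow_right (by omega)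
  have hstep : ∀ n, k₂ ≤ n → n ≤ k → f ∈ m ^ n := by
    intro n hn
    induction n, hn using Nat.le_induction with
    | base => exact fun _ => hc k₂ f (hle hxf)
    | succ n hn ih =>
      intro hnk
      have hle : m ^ (k + 1) ≤ m ^ (n + 2) := Ideal.pow_le_pow_right (by omega)
      exact h₂ n hn f (ih (by omega)) (hle hxf)
  exact h₃ k (by omega) f (hstep k (by omega) le_rfl) hf'

/-- A generic element `x` of `m` is superficial for the powers of `m` times `I`. -/
theorem exists_finset_colon_eq [IsNoetherianRing R] {m I : Ideal R} (hm : m.IsPrime)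
    {a : R} (ha : a ∈ m) (hreg : IsSMulRegular R a) (hbot : IsSaturatedAt m ⊥)
    (hpow : ∀ k, IsSaturatedAt m (m ^ k)) (hI : ∀ k, IsSaturatedAt m (I * m ^ k)) :
    ∃ T : Finset (Submodule (R ⧸ m) m.Cotangent), ⊤ ∉ T ∧ ∀ x : m,
      (∀ W ∈ T, m.toCotangent x ∉ W) →
      ∃ k₀, ∀ k, k₀ ≤ k → (I * m ^ k * m).colon {(x : R)} = I * m ^ k := by
  classical
  have := nontrivial_cotangent hm.ne_top ha hreg
  obtain ⟨T₁, hT₁, H₁⟩ := exists_finset_superficial hm (J := ⊥)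
    (fun k => by rw [Ideal.bot_mul]; exact hbot)
  obtain ⟨T₂, hT₂, H₂⟩ := exists_finset_superficial hm (J := m)
    (fun k => by rw [← pow_succ']; exact hpow _)
  obtain ⟨T₃, hT₃, H₃⟩ := exists_finset_superficial hm hI
  refine ⟨T₁ ∪ (T₂ ∪ T₃), ?_, fun x hx => ?_⟩
  · rw [Finset.mem_union, Finset.mem_union]
    exact not_or_intro hT₁ (not_or_intro hT₂ hT₃)
  obtain ⟨k₁, H₁⟩ := H₁ x fun W hW => hx W (Finset.mem_union_left _ hW)
  obtain ⟨k₂, H₂⟩ := H₂ x fun W hW =>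
    hx W (Finset.mem_union_right _ (Finset.mem_union_left _ hW))
  obtain ⟨k₃, H₃⟩ := H₃ x fun W hW =>
    hx W (Finset.mem_union_right _ (Finset.mem_union_right _ hW))
  simp only [Ideal.bot_mul, Ideal.mem_bot] at H₁
  simp only [← pow_succ'] at H₂
  exact exists_colon_eq ha hreg x.2 (H₁ k₁ le_rfl) H₂ H₃

/-- If `(I m ^ (k + 1) : x) = I m ^ k` for all large `k`, then the same holds whenever `I m ^ k`
and the subsequent ideals are weakly `m`-full. -/
theorem colon_eq_of_isWeaklyMFull {m I : Ideal R} {x : R} (hx : x ∈ m) {k₀ l : ℕ}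
    (hk₀ : ∀ k, k₀ ≤ k → (I * m ^ k * m).colon {x} = I * m ^ k)
    (hl : ∀ k, l ≤ k → IsWeaklyMFull m (I * m ^ k)) :
    ∀ k, l ≤ k → (I * m ^ k * m).colon {x} = I * m ^ k := by
  -- Descending induction on `k`, with `n` bounding the distance to `k₀`. If `x f ∈ I m ^ (k + 1)`
  -- and `b ∈ m`, then `x f b ∈ I m ^ (k + 2)`, so `f b ∈ I m ^ (k + 1)` by the case `k + 1`. Hence
  -- `f ∈ (I m ^ (k + 1) : m) = I m ^ k`.
  have key : ∀ n k, l ≤ k → k₀ ≤ k + n → (I * m ^ k * m).colon {x} = I * m ^ k := by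
    intro n
    induction n with
    | zero => exact fun k _ hk => hk₀ k hk
    | succ n ih =>
      intro k hlk hk
      refine le_antisymm (fun f hf => ?_) (le_colon_singleton hx)
      rw [← hl k hlk, Submodule.mem_colon]
      intro b hb
      rw [Submodule.mem_colon_singleton] at hf
      have h := ih (k + 1) (by omega) (by omega)
      rw [pow_succ, ← mul_assoc] at h
      rw [← h, Submodule.mem_colon_singleton]
      simp only [smul_eq_mul] at hf ⊢
      rw [mul_right_comm f]
      exact Ideal.mul_mem_mul hf hb
  exact fun k hk => key k₀ k hk (by omega)

/-- If `x f ∈ J` and `b ∈ m`, then `x f b ∈ J m`, so `f b ∈ (J m : x) = J`. -/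
theorem IsMFull.isFull {m J : Ideal R} (h : IsMFull m J) : IsFull m J := by
  refine ForGeneric.mono h fun x hx hJ => le_antisymm (fun f hf => ?_) (fun f hf => ?_)
  · rw [Submodule.mem_colon]
    intro b hb
    rw [← hJ]
    rw [Submodule.mem_colon_singleton] at hf ⊢
    simp only [smul_eq_mul] at hf ⊢
    rw [mul_right_comm f]
    exact Ideal.mul_mem_mul hf hb
  · exact Submodule.mem_colon_singleton.2 (Submodule.mem_colon.1 hf x hx)

theorem le_colon_self (m J : Ideal R) : J ≤ (J * m).colon (m : Set R) :=
  fun _ hf => Submodule.mem_colon.2 fun _ hb => Ideal.mul_mem_mul hf hb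

theorem IsMFull.isWeaklyMFull {m J : Ideal R} [m.IsMaximal] [Infinite (R ⧸ m)]
    [Nontrivial m.Cotangent] (h : IsMFull m J) : IsWeaklyMFull m J := by
  obtain ⟨x, hx, hJ⟩ := ForGeneric.exists h
  refine le_antisymm (fun f hf => ?_) (le_colon_self m J)
  rw [← hJ]
  exact Submodule.mem_colon_singleton.2 (Submodule.mem_colon.1 hf x hx)

theorem daoSet_nonempty_and_eq [IsNoetherianRing R] {m I : Ideal R} [hm : m.IsMaximal]
    [Infinite (R ⧸ m)] {a : R} (ha : a ∈ m) (hreg : IsSMulRegular R a)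
    (hbot : IsSaturatedAt m ⊥) (hpow : ∀ k, IsSaturatedAt m (m ^ k))
    (hI : ∀ k, IsSaturatedAt m (I * m ^ k)) :
    (daoSet₃ m I).Nonempty ∧ daoSet₁ m I = daoSet₃ m I := by
  have := nontrivial_cotangent hm.ne_top ha hreg
  obtain ⟨T, hT, H⟩ := exists_finset_colon_eq hm.isPrime ha hreg hbot hpow hI
  let _ := Ideal.Quotient.field m
  obtain ⟨U, hU, ⟨v, hv⟩, hUT⟩ := exists_isZariskiOpen_avoiding T hT
  refine ⟨?_, Set.Subset.antisymm (fun l hl k hk => (hl k hk).isWeaklyMFull) fun l hl k hk => ?_⟩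
  -- A single superficial `x` suffices here, since `(J m : m) ⊆ (J m : x)`.
  · obtain ⟨x, rfl⟩ := m.toCotangent_surjective v
    obtain ⟨k₀, h⟩ := H x (hUT _ hv)
    refine ⟨k₀, fun k hk => le_antisymm (fun f hf => ?_) (le_colon_self m _)⟩
    rw [← h k hk]
    exact Submodule.mem_colon_singleton.2 (Submodule.mem_colon.1 hf x x.2)
  · refine ⟨U, hU, ⟨v, hv⟩, fun x _ hxU => ?_⟩
    obtain ⟨k₀, h⟩ := H x (hUT _ hxU)
    exact colon_eq_of_isWeaklyMFull x.2 h hl k hk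

end Superficial

/-! ### Regularity of modules killed by the irrelevant ideal -/

section Regularity

variable {A M : Type*} [CommRing A] [AddCommGroup M] [Module A M]

theorem koszulD_eq_zero {n : ℕ} {y : Fin n → A} (hy : ∀ a, ∀ d : M, y a • d = 0) :
    koszulD M y = 0 := by
  refine LinearMap.ext fun c => funext fun T => ?_
  change ∑ a ∈ Tᶜ, (-1 : A) ^ (T.filter (· < a)).card • y a • c (insert a T) = 0
  simp [hy]

theorem exists_ne_bot_of_nontrivial_koszulHomology {ℳ : ℕ → AddSubgroup M} {n : ℕ}
    {y : Fin n → A} {i j : ℕ} (h : Nontrivial (KoszulHomology ℳ y i j)) :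
    ∃ k : ℕ, (j : ℤ) - i = k ∧ ℳ k ≠ ⊥ := by
  have hne : gradedPiece ℳ ((j : ℤ) - i) ≠ ⊥ := by
    intro hbot
    have : Subsingleton (koszulCycles ℳ y i j) := by
      refine ⟨fun c c' => Subtype.ext (funext fun S => ?_)⟩
      have h0 : ∀ c : koszulCycles ℳ y i j, (c : Finset (Fin n) → M) S = 0 := by
        intro c
        by_cases hS : S.card = i
        · have := (c.2.1 S).1 hS
          rwa [hbot, AddSubgroup.mem_bot] at this
        · exact (c.2.1 S).2 hS
      rw [h0, h0]
    exact not_subsingleton (KoszulHomology ℳ y i j)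
      (QuotientAddGroup.mk_surjective.subsingleton)
  unfold gradedPiece at hne
  split_ifs at hne with h0
  · exact ⟨((j : ℤ) - i).toNat, (Int.toNat_of_nonneg h0).symm, hne⟩
  · exact absurd rfl hne

/-- With zero differential there are no nonzero boundaries, so `d • e_∅` represents a nonzero class
for every nonzero `d` of degree `k`. -/
theorem nontrivial_koszulHomology_zero {ℳ : ℕ → AddSubgroup M} {n : ℕ}
    {y : Fin n → A} (hy : ∀ a, ∀ d : M, y a • d = 0) {k : ℕ} (hk : ℳ k ≠ ⊥) :
    Nontrivial (KoszulHomology ℳ y 0 k) := by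
  classical
  obtain ⟨⟨d, hd⟩, hne⟩ := AddSubgroup.ne_bot_iff_exists_ne_zero.1 hk
  have hd0 : d ≠ 0 := fun h => hne (Subtype.ext h)
  let c : Finset (Fin n) → M := fun S => if S = ∅ then d else 0
  have hc : c ∈ koszulCycles ℳ y 0 k := by
    refine ⟨fun S => ⟨fun hS => ?_, fun hS => ?_⟩, ?_⟩
    · rw [Finset.card_eq_zero] at hS
      simpa [c, hS, gradedPiece] using hd
    · rw [Finset.card_ne_zero, Finset.nonempty_iff_ne_empty] at hS
      simp [c, hS]
    · rw [koszulD_eq_zero hy]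
      rfl
  refine ⟨⟨QuotientAddGroup.mk ⟨c, hc⟩, 0, fun h => ?_⟩⟩
  rw [QuotientAddGroup.eq_zero_iff, AddSubgroup.mem_addSubgroupOf] at h
  obtain ⟨b, -, hb⟩ := h
  rw [koszulD_eq_zero hy] at hb
  have h := congrFun hb ∅
  refine hd0 ?_
  simpa [c] using h.symm

/-- A generating family of least length is irredundant, as a redundant member could be dropped. -/
theorem exists_isMinimalGenerators {𝒜 : ℕ → AddSubgroup A} [GradedRing 𝒜]
    (h : ∃ (n : ℕ) (y : Fin n → A), (∀ a, y a ∈ 𝒜 1) ∧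
      Ideal.span (Set.range y) = (HomogeneousIdeal.irrelevant 𝒜).toIdeal) :
    ∃ (n : ℕ) (y : Fin n → A), IsMinimalGenerators 𝒜 y := by
  classical
  obtain ⟨y, hy1, hy2⟩ := Nat.find_spec h
  refine ⟨Nat.find h, y, hy1, hy2, fun a ha => ?_⟩
  have hmin := fun {m : ℕ} => Nat.find_min h (m := m)
  revert y hmin a
  generalize Nat.find h = n
  intro y hy1 hy2 a ha hmin
  cases n with
  | zero => exact a.elim0
  | succ n =>
    refine hmin n.lt_succ_self ⟨y ∘ a.succAbove, fun i => hy1 _, ?_⟩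
    rw [Set.range_comp, Fin.range_succAbove, ← hy2]
    refine le_antisymm (Ideal.span_mono (Set.image_subset_range _ _)) (Ideal.span_le.2 ?_)
    rintro _ ⟨b, rfl⟩
    by_cases hb : b = a
    · exact hb ▸ ha
    · exact Ideal.subset_span ⟨b, hb, rfl⟩

/-- If the irrelevant ideal annihilates `M`, then the regularity of `M` is its top degree. -/
theorem hasRegularity_of_smul_eq_zero {𝒜 : ℕ → AddSubgroup A} [GradedRing 𝒜]
    {ℳ : ℕ → AddSubgroup M} [DirectSum.Decomposition ℳ] [SetLike.GradedSMul 𝒜 ℳ]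
    (hgen : ∃ (n : ℕ) (y : Fin n → A), (∀ a, y a ∈ 𝒜 1) ∧
      Ideal.span (Set.range y) = (HomogeneousIdeal.irrelevant 𝒜).toIdeal)
    (hM : ∀ a ∈ 𝒜 1, ∀ d : M, a • d = 0) {r : ℕ} (hr : ℳ r ≠ ⊥)
    (hmax : ∀ k, r < k → ℳ k = ⊥) : HasRegularity 𝒜 ℳ r := by
  refine ⟨exists_isMinimalGenerators hgen, fun n y hy => ⟨⟨0, r,
    nontrivial_koszulHomology_zero (fun a => hM _ (hy.mem_one a)) hr, by simp⟩, ?_⟩⟩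
  rintro _ ⟨i, j, hij, rfl⟩
  obtain ⟨k, hk, hne⟩ := exists_ne_bot_of_nontrivial_koszulHomology hij
  rw [hk, Int.ofNat_le]
  by_contra! h
  exact hne (hmax k h)

end Regularity

/-! ### Generators of the irrelevant ideal of the Rees algebra -/

section Rees

variable {R : Type*} [CommRing R] {m : Ideal R}

theorem reesDegreeOne_mem (a : m) : reesDegreeOne m a ∈ reesGrading m 1 :=
  fun _ hj => coeff_monomial_of_ne _ hj

theorem exists_eq_reesDegreeOne {f : reesAlgebra m} (hf : f ∈ reesGrading m 1) :
    ∃ a : m, reesDegreeOne m a = f := by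
  refine ⟨⟨(f : R[X]).coeff 1, by simpa using f.2 1⟩, Subtype.ext (Polynomial.ext fun j => ?_)⟩
  rcases eq_or_ne j 1 with rfl | h
  · exact coeff_monomial_same _ _
  · exact (coeff_monomial_of_ne _ h).trans (hf j h).symm

theorem irrelevant_reesGrading :
    (HomogeneousIdeal.irrelevant (reesGrading m)).toIdeal = reesIrrelevant m := by
  rw [HomogeneousIdeal.irrelevant_eq_span]
  refine le_antisymm (Ideal.span_le.2 ?_) (Ideal.span_mono ?_)
  · intro (f : reesAlgebra m) hf
    simp only [Set.mem_iUnion] at hf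
    obtain ⟨i, hi, hf⟩ := hf
    have hle : reesIrrelevant m ^ i ≤ reesIrrelevant m := Ideal.pow_le_self hi.ne'
    have h := hle (monomial_mem_reesIrrelevant_pow m i (f.2 i))
    rw [SetLike.mem_coe]
    convert h using 1
    refine Subtype.ext (Polynomial.ext fun j => ?_)
    rcases eq_or_ne j i with rfl | h
    · exact (coeff_monomial_same _ _).symm
    · exact (hf j h).trans (coeff_monomial_of_ne _ h).symm
  · rintro _ ⟨a, rfl⟩
    simp only [Set.mem_iUnion]
    exact ⟨1, one_pos, reesDegreeOne_mem a⟩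

theorem exists_span_eq_irrelevant [IsNoetherianRing R] (m : Ideal R) :
    ∃ (n : ℕ) (y : Fin n → reesAlgebra m), (∀ a, y a ∈ reesGrading m 1) ∧
      Ideal.span (Set.range y) = (HomogeneousIdeal.irrelevant (reesGrading m)).toIdeal := by
  obtain ⟨n, s, hs⟩ := Module.Finite.exists_fin (R := R) (M := m)
  refine ⟨n, fun i => reesDegreeOne m (s i), fun i => reesDegreeOne_mem _, ?_⟩
  rw [irrelevant_reesGrading]
  refine le_antisymm (Ideal.span_mono ?_) (Ideal.span_le.2 ?_)
  · rintro _ ⟨i, rfl⟩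
    exact ⟨s i, rfl⟩
  · rintro _ ⟨a, rfl⟩
    have ha : a ∈ Submodule.span R (Set.range s) := hs ▸ Submodule.mem_top
    induction ha using Submodule.span_induction with
    | mem a ha =>
      obtain ⟨i, rfl⟩ := ha
      exact Ideal.subset_span ⟨i, rfl⟩
    | zero => simp
    | add a b _ _ ha hb => rw [map_add]; exact add_mem ha hb
    | smul r a _ ha =>
      rw [map_smul, Algebra.smul_def]
      exact Ideal.mul_mem_left _ _ ha

end Rees

/-! ### Structure and regularity of the Dao module -/

section DaoModule

variable {R : Type*} [CommRing R] (m I : Ideal R)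

theorem reesGrading_one_smul_daoModule {y : reesAlgebra m} (hy : y ∈ reesGrading m 1)
    (d : DaoModule m I) : y • d = 0 := by
  obtain ⟨a, rfl⟩ := exists_eq_reesDegreeOne hy
  obtain ⟨f, rfl⟩ := Subquotient.mk_surjective _ _ d
  refine ((daoMk m I).map_smul _ f).symm.trans ((Subquotient.mk_eq_zero _ _ _).2 fun k => ?_)
  change (monomial 1 (a : R) * (f : R[X])).coeff k ∈ I * m ^ k
  cases k with
  | zero => simp
  | succ k =>
    rw [coeff_monomial_mul, mul_comm (a : R)]
    exact Submodule.mem_colon.1 (f.2 k) a a.2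

theorem isWeaklyMFull_iff (k : ℕ) :
    IsWeaklyMFull m (I * m ^ k) ↔ (I * m ^ (k + 1)).colon (m : Set R) = I * m ^ k := by
  rw [IsWeaklyMFull, mul_assoc, ← pow_succ]

variable {m I} in
theorem monomial_mem_colonModule {k : ℕ} {b : R}
    (hb : b ∈ (I * m ^ (k + 1)).colon (m : Set R)) : monomial k b ∈ colonModule m I := by
  intro j
  rcases eq_or_ne j k with rfl | h
  · rwa [coeff_monomial_same]
  · rw [coeff_monomial_of_ne _ h]
    exact zero_mem _

theorem daoGrading_eq_bot_iff (k : ℕ) :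
    daoGrading m I k = ⊥ ↔ IsWeaklyMFull m (I * m ^ k) := by
  rw [isWeaklyMFull_iff]
  refine ⟨fun h => le_antisymm (fun b hb => ?_) ?_, fun h => ?_⟩
  · have hmem : daoMk m I ⟨_, monomial_mem_colonModule hb⟩ ∈ daoGrading m I k :=
      ⟨_, fun j hj => coeff_monomial_of_ne _ hj, rfl⟩
    rw [h, AddSubgroup.mem_bot, Subquotient.mk_eq_zero] at hmem
    have := hmem k
    rwa [coeff_monomial_same] at this
  · rw [pow_succ, ← mul_assoc]
    exact fun _ hf => Submodule.mem_colon.2 fun _ hb => Ideal.mul_mem_mul hf hb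
  · rw [eq_bot_iff]
    rintro _ ⟨f, hf, rfl⟩
    rw [AddSubgroup.mem_bot, Subquotient.mk_eq_zero]
    intro j
    rcases eq_or_ne j k with rfl | hj
    · exact h.le (f.2 j)
    · rw [hf j hj]
      exact zero_mem _

theorem subsingleton_daoModule_iff :
    Subsingleton (DaoModule m I) ↔ ∀ k, IsWeaklyMFull m (I * m ^ k) := by
  refine ⟨fun h k => (daoGrading_eq_bot_iff m I k).1 (Subsingleton.elim _ _), fun h => ?_⟩
  refine subsingleton_of_forall_eq 0 fun d => ?_
  obtain ⟨f, rfl⟩ := Subquotient.mk_surjective _ _ d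
  rw [Subquotient.mk_eq_zero]
  intro k
  exact ((isWeaklyMFull_iff m I k).1 (h k)).le (f.2 k)

/-- Only the degrees below `l` can be nonzero, and each graded part is finitely generated already
over `R`. -/
theorem daoModule_finite [IsNoetherianRing R] (h : (daoSet₃ m I).Nonempty) :
    Module.Finite (reesAlgebra m) (DaoModule m I) := by
  classical
  obtain ⟨l, hl⟩ := h
  have hfg : ∀ k, ∃ s : Finset (DaoModule m I), ∀ d ∈ daoGrading m I k,
      d ∈ Submodule.span (reesAlgebra m) (s : Set (DaoModule m I)) := by
    intro k
    obtain ⟨n, g, hg⟩ := Module.Finite.exists_fin (R := R)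
      (M := ((I * m ^ (k + 1)).colon (m : Set R) : Ideal R))
    let y : ((I * m ^ (k + 1)).colon (m : Set R) : Ideal R) → DaoModule m I := fun b =>
      daoMk m I ⟨_, monomial_mem_colonModule b.2⟩
    have hy : ∀ b, y b ∈ Submodule.span (reesAlgebra m)
        ((Finset.univ.image (y ∘ g) : Finset (DaoModule m I)) : Set (DaoModule m I)) := by
      intro b
      have hb : b ∈ Submodule.span R (Set.range g) := hg ▸ Submodule.mem_top
      induction hb using Submodule.span_induction with
      | mem b hb =>
        obtain ⟨i, rfl⟩ := hb
        exact Submodule.subset_span (by simp)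
      | zero =>
        have : y 0 = 0 := by
          rw [Subquotient.mk_eq_zero]
          simp
        rw [this]
        exact zero_mem _
      | add b c _ _ hb hc =>
        have : y (b + c) = y b + y c := by
          refine Eq.trans ?_ ((daoMk m I).map_add _ _)
          exact congrArg (daoMk m I) (Subtype.ext (map_add (monomial k) (b : R) c))
        rw [this]
        exact add_mem hb hc
      | smul r b _ hb =>
        have : y (r • b) = algebraMap R (reesAlgebra m) r • y b := by
          refine Eq.trans ?_ ((daoMk m I).map_smul _ _)
          refine congrArg (daoMk m I) (Subtype.ext ?_)
          change monomial k (r * (b : R)) = C r * monomial k (b : R)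
          rw [C_mul_monomial]
        rw [this]
        exact Submodule.smul_mem _ _ hb
    refine ⟨Finset.univ.image (y ∘ g), ?_⟩
    rintro _ ⟨f, hf, rfl⟩
    convert hy ⟨_, f.2 k⟩ using 1
    refine congrArg (daoMk m I) (Subtype.ext (Polynomial.ext fun j => ?_))
    rcases eq_or_ne j k with rfl | h
    · exact (coeff_monomial_same _ _).symm
    · exact (hf j h).trans (coeff_monomial_of_ne _ h).symm
  choose s hs using hfg
  refine ⟨⟨(Finset.range l).biUnion s, eq_top_iff.2 fun d _ => ?_⟩⟩
  rw [← DirectSum.sum_support_decompose (daoGrading m I) d]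
  refine sum_mem fun k _ => ?_
  have hk := (DirectSum.decompose (daoGrading m I) d k).2
  by_cases hkl : k < l
  · refine Submodule.span_mono ?_ (hs k _ hk)
    exact_mod_cast Finset.subset_biUnion_of_mem s (Finset.mem_range.2 hkl)
  · have h0 := ((daoGrading_eq_bot_iff m I k).2 (hl k (not_lt.1 hkl))).le hk
    rw [AddSubgroup.mem_bot.1 h0]
    exact zero_mem _

theorem exists_hasRegularity_daoModule [IsNoetherianRing R] (h : (daoSet₃ m I).Nonempty)
    (hD : Nontrivial (DaoModule m I)) :
    ∃ r : ℤ, HasRegularity (reesGrading m) (daoGrading m I) r ∧ (daoNumber₃ m I : ℤ) = r + 1 := by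
  have hmem : daoNumber₃ m I ∈ daoSet₃ m I := Nat.sInf_mem h
  have hpos : daoNumber₃ m I ≠ 0 := fun h0 => by
    rw [h0] at hmem
    exact not_subsingleton _ ((subsingleton_daoModule_iff m I).2 fun k => hmem k (Nat.zero_le k))
  obtain ⟨r, hr⟩ := Nat.exists_eq_succ_of_ne_zero hpos
  refine ⟨r, hasRegularity_of_smul_eq_zero (exists_span_eq_irrelevant m)
    (fun y hy d => reesGrading_one_smul_daoModule m I hy d) (fun hbot => ?_) fun k hk =>
      (daoGrading_eq_bot_iff m I k).2 (hmem k (by omega)), by rw [hr]; simp⟩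
  -- If degree `r = d₃ - 1` vanished as well, `r` would contradict the minimality of `d₃`.
  have : r ∈ daoSet₃ m I := by
    intro k hk
    rcases hk.eq_or_lt with rfl | hk
    · exact (daoGrading_eq_bot_iff m I r).1 hbot
    · exact hmem k (by omega)
  have : daoNumber₃ m I ≤ r := Nat.sInf_le this
  omega

end DaoModule

/-! ### Saturation in the local and in the graded case -/

section Setting

theorem isSaturatedAt_of_isLocalSetting {R : Type*} [CommRing R] {m : Ideal R}
    (hm : IsLocalSetting m) (J : Ideal R) : IsSaturatedAt m J := by
  obtain ⟨_, rfl⟩ := hm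
  intro s f hs hf
  rw [IsLocalRing.mem_maximalIdeal, mem_nonunits_iff, not_not] at hs
  exact (Ideal.unit_mul_mem_iff_mem J hs).1 hf

variable {K R : Type*} [Field K] [CommRing R] [Algebra K R] {𝒜 : ℕ → Submodule K R}
  [GradedAlgebra 𝒜]

theorem IsStandardGraded.exists_algebraMap_eq (h : IsStandardGraded 𝒜) {s : R}
    (hs : s ∉ HomogeneousIdeal.irrelevant 𝒜) :
    ∃ c : K, c ≠ 0 ∧ algebraMap K R c = DirectSum.decompose 𝒜 s 0 := by
  have h0 : (DirectSum.decompose 𝒜 s 0 : R) ∈ (1 : Submodule K R) :=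
    h.zero_eq ▸ (DirectSum.decompose 𝒜 s 0).2
  obtain ⟨c, hc⟩ := Submodule.mem_one.1 h0
  refine ⟨c, ?_, hc⟩
  rintro rfl
  rw [HomogeneousIdeal.mem_irrelevant_iff, GradedRing.proj_apply] at hs
  exact hs (by rw [← hc, map_zero])

theorem IsStandardGraded.isMaximal (h : IsStandardGraded 𝒜) :
    (HomogeneousIdeal.irrelevant 𝒜).toIdeal.IsMaximal := by
  have : Nontrivial R := h.algebraMap_injective.nontrivial
  refine Ideal.isMaximal_iff.2 ⟨fun h1 => ?_, fun J s hJ hs hsJ => ?_⟩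
  · rw [HomogeneousIdeal.mem_iff, HomogeneousIdeal.mem_irrelevant_iff, GradedRing.proj_apply,
      DirectSum.decompose_of_mem_same 𝒜 SetLike.GradedOne.one_mem] at h1
    exact one_ne_zero h1
  · obtain ⟨c, hc, hcs⟩ := h.exists_algebraMap_eq hs
    have h1 : s - algebraMap K R c ∈ J := hJ (by
      rw [HomogeneousIdeal.mem_iff, HomogeneousIdeal.mem_irrelevant_iff, map_sub, hcs,
        GradedRing.proj_apply, GradedRing.proj_apply,
        DirectSum.decompose_of_mem_same 𝒜 (DirectSum.decompose 𝒜 s 0).2, sub_self])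
    have h2 := J.mul_mem_left (algebraMap K R c⁻¹) 
      (by simpa using sub_mem hsJ h1)
    rwa [← map_mul, inv_mul_cancel₀ hc, map_one] at h2

/-- The degree zero component of `s` is a nonzero constant `c`. In degree `i`, `s f` equals `c fᵢ`
plus multiples of components of `f` of lower degree, so induction on `i` puts every `fᵢ` into `J`.
-/
theorem IsStandardGraded.isSaturatedAt (h : IsStandardGraded 𝒜) {J : Ideal R}
    (hJ : J.IsHomogeneous 𝒜) : IsSaturatedAt (HomogeneousIdeal.irrelevant 𝒜).toIdeal J := by
  intro s f hs hf
  obtain ⟨c, hc, hcs⟩ := h.exists_algebraMap_eq hs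
  rw [hJ.mem_iff]
  intro i
  induction i using Nat.strong_induction_on with
  | _ i ih =>
    have hi := (hJ.mem_iff).1 hf i
    rw [DirectSum.decompose_mul, DirectSum.coe_mul_apply_eq_sum_antidiagonal,
      Finset.Nat.sum_antidiagonal_eq_sum_range_succ
        (fun p q => (DirectSum.decompose 𝒜 s p : R) * DirectSum.decompose 𝒜 f q),
      Finset.sum_range_succ'] at hi
    rw [Submodule.add_mem_iff_right _ (sum_mem fun p hp => J.mul_mem_left _
      (ih _ (by rw [Finset.mem_range] at hp; omega))), ← hcs, Nat.sub_zero] at hi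
    have h2 := J.mul_mem_left (algebraMap K R c⁻¹) hi
    rwa [← mul_assoc, ← map_mul, inv_mul_cancel₀ hc, map_one, one_mul] at h2

theorem isHomogeneous_pow {J : Ideal R} (hJ : J.IsHomogeneous 𝒜) (k : ℕ) :
    (J ^ k).IsHomogeneous 𝒜 := by
  induction k with
  | zero =>
    rw [pow_zero, Ideal.one_eq_top]
    exact Ideal.IsHomogeneous.top 𝒜
  | succ k ih =>
    rw [pow_succ]
    exact ih.mul hJ

end Setting

/-! ### Conclusion for both settings -/

theorem daoNumbers_of_isSaturatedAt {R : Type*} [CommRing R] [IsNoetherianRing R] {m I : Ideal R}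
    [hm : m.IsMaximal] [Infinite (R ⧸ m)] (hdepth : 0 < depth m)
    (hbot : IsSaturatedAt m ⊥) (hpow : ∀ k, IsSaturatedAt m (m ^ k))
    (hI : ∀ k, IsSaturatedAt m (I * m ^ k)) :
    (daoSet₁ m I).Nonempty ∧ (daoSet₂ m I).Nonempty ∧ (daoSet₃ m I).Nonempty ∧
    daoNumber₂ m I ≤ daoNumber₁ m I ∧
    daoNumber₁ m I = daoNumber₃ m I ∧
    Module.Finite (reesAlgebra m) (DaoModule m I) ∧
    (Nontrivial (DaoModule m I) → ∃ r : ℤ,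
      HasRegularity (reesGrading m) (daoGrading m I) r ∧ (daoNumber₁ m I : ℤ) = r + 1) ∧
    (Subsingleton (DaoModule m I) → daoNumber₁ m I = 0) := by
  obtain ⟨a, ha, hreg⟩ := exists_mem_isSMulRegular_of_depth_pos hdepth
  obtain ⟨hne, heq⟩ := daoSet_nonempty_and_eq ha hreg hbot hpow hI
  have hnum : daoNumber₁ m I = daoNumber₃ m I := by rw [daoNumber₁, heq, daoNumber₃]
  have hsub : daoSet₁ m I ⊆ daoSet₂ m I := fun l hl k hk => (hl k hk).isFull
  have hne₁ : (daoSet₁ m I).Nonempty := heq ▸ hne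
  refine ⟨hne₁, hne₁.mono hsub, hne, Nat.sInf_le (hsub (Nat.sInf_mem hne₁)), hnum,
    daoModule_finite m I hne, fun hD => hnum ▸ exists_hasRegularity_daoModule m I hne hD,
    fun hD => ?_⟩
  rw [hnum, daoNumber₃, Nat.sInf_eq_zero]
  exact Or.inl fun k _ => (subsingleton_daoModule_iff m I).1 hD k

end DaoNumbers

theorem corollary1p2 {R : Type u} [CommRing R] [IsNoetherianRing R] (m I : Ideal R)
    (hR : IsLocalSetting m ∨ IsGradedSetting.{v} m I)
    (hK : Infinite (R ⧸ m)) (hdepth : 0 < depth m) :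
    (daoSet₁ m I).Nonempty ∧ (daoSet₂ m I).Nonempty ∧ (daoSet₃ m I).Nonempty ∧
    daoNumber₂ m I ≤ daoNumber₁ m I ∧
    daoNumber₁ m I = daoNumber₃ m I ∧
    Module.Finite (reesAlgebra m) (DaoModule m I) ∧
    (Nontrivial (DaoModule m I) → ∃ r : ℤ,
      HasRegularity (reesGrading m) (daoGrading m I) r ∧ (daoNumber₁ m I : ℤ) = r + 1) ∧
    (Subsingleton (DaoModule m I) → daoNumber₁ m I = 0) := by
  have := hK
  rcases hR with hR | ⟨K, _, _, 𝒜, _, hstd, rfl, hI⟩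
  · have : m.IsMaximal := by
      obtain ⟨_, rfl⟩ := hR
      infer_instance
    have hsat := isSaturatedAt_of_isLocalSetting hR
    exact daoNumbers_of_isSaturatedAt hdepth (hsat ⊥) (fun _ => hsat _) fun _ => hsat _
  · have := hstd.isMaximal
    have hm := (HomogeneousIdeal.irrelevant 𝒜).isHomogeneous
    exact daoNumbers_of_isSaturatedAt hdepth (hstd.isSaturatedAt (Ideal.IsHomogeneous.bot 𝒜))
      (fun k => hstd.isSaturatedAt (isHomogeneous_pow hm k))
      fun k => hstd.isSaturatedAt (hI.mul (isHomogeneous_pow hm k))
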